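/- Let $G,H:\mathbb R^2\to\mathbb R$ be $C^1$ functions and consider on $\mathbb R^2$ the discontinuous vector field $F$ given by $\dot x=G(x,y)$ and $$\dot y=\begin{cases}-|H|,&y>1,\\ \tfrac{H-|H|}{2},&y=1,\\ H,&0<y<1,\\ \tfrac{H+|H|}{2},&y=0,\\ |H|,&y<0,\end{cases}\qquad H=H(x,y).$$ A Filippov solution on an interval $J\subseteq\mathbb R$ is a function $z=(x,y):J\to\mathbb R^2$ that is absolutely continuous on every compact subinterval of $J$ and satisfies, for almost every $t\in J$, $$\dot z(t)\in\bigcap_{\delta>0}\ \bigcap_{|N|=0}\overline{\mathrm{conv}}\,F\bigl(B(z(t),\delta)\setminus N\bigr),$$ where $N$ runs through the Lebesgue null sets of $\mathbb R^2$. Then the following hold. 1. (Unique forward solution.) For every $z_0\in\mathbb R^2$ there are $T\in(0,\infty]$ and a Filippov solution $z$ on $[0,T)$ with $z(0)=z_0$ such that every Filippov solution $w$ on any interval $J\subseteq[0,\infty)$ with $0\in J$ and $w(0)=z_0$ satisfies $J\subseteq[0,T)$ and $w=z$ on $J$. 2. (Forward invariance.) If $w$ is a Filippov solution on an interval $J$,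 $s\le t$ are in $J$ and $w(s)\in\mathbb R\times[0,1]$, then $w(t)\in\mathbb R\times[0,1]$. 3. (Motion on the boundary lines.) Let $w=(x,y)$ be a Filippov solution on an interval $J$. For almost every $t\in J$ with $y(t)\in\{0,1\}$ one has $\dot x(t)=G(w(t))$ and $\dot y(t)=0$. Moreover, let $s\le t$ be in $J$. If $y(s)=1$ and $H(x(r),1)\ge 0$ for all $r\in[s,t]$, then $w$ slides along the line $y=1$ on $[s,t]$: for all $r\in[s,t]$, $y(r)=1$, and $w$ is differentiable at $r$ (relative to $[s,t]$) with $\dot x(r)=G(x(r),1)$, $\dot y(r)=0$. Likewise, if $y(s)=0$ and $H(x(r),0)\le 0$ for all $r\in[s,t]$, then for all $r\in[s,t]$, $y(r)=0$, and $w$ is differentiable at $r$ (relative to $[s,t]$) with $\dot x(r)=G(x(r),0)$, $\dot y(r)=0$. -/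

import Mathlib

open Set MeasureTheory

noncomputable section

/-- The planar piecewise vector field `(G, Y)` built from `G` and `H`, where `Y` is `H` inside the
strip `0 < y < 1`, `-|H|` above it, `|H|` below it, and the average of the two adjacent values on
each of the boundary lines. -/
def stripField (G H : ℝ × ℝ → ℝ) (p : ℝ × ℝ) : ℝ × ℝ :=
  (G p,
    if 1 < p.2 then -|H p|
    else if p.2 = 1 then (H p - |H p|) / 2
    else if 0 < p.2 then H p
    else if p.2 = 0 then (H p + |H p|) / 2
    else |H p|)

/-- The Filippov set-valued regularization of a planar vector field `f` at `p`: the intersection,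
over all `δ > 0` and all Lebesgue null sets `N`, of the closed convex hulls of `f (B(p, δ) \ N)`. -/
def filippovSet (f : ℝ × ℝ → ℝ × ℝ) (p : ℝ × ℝ) : Set (ℝ × ℝ) :=
  ⋂ (δ : ℝ) (_ : 0 < δ) (N : Set (ℝ × ℝ)) (_ : volume N = 0),
    closure (convexHull ℝ (f '' (Metric.ball p δ \ N)))

/-- `z` is a Filippov solution of `ż = f(z)` on the interval `J` (open, closed or half-open,
bounded or not): it is absolutely continuous on every compact subinterval of `J`, and for almost
every time `t` in `J` it is differentiable at `t` with derivative in the Filippov set of `f` at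
`z t`. Only the values of `z` on `J` matter. -/
structure IsFilippovSolution (f : ℝ × ℝ → ℝ × ℝ) (J : Set ℝ) (z : ℝ → ℝ × ℝ) : Prop where
  ordConnected : J.OrdConnected
  absolutelyContinuous : ∀ a ∈ J, ∀ b ∈ J, a ≤ b → AbsolutelyContinuousOnInterval z a b
  ae_hasDerivAt : ∀ᵐ t : ℝ, t ∈ interior J → ∃ v ∈ filippovSet f (z t), HasDerivAt z v t

/-- The forward time interval `[0, T)`, where `T` may be `+∞`. -/
def forwardInterval (T : EReal) : Set ℝ := {t : ℝ | 0 ≤ t ∧ (t : EReal) < T}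

/-- The closed strip `ℝ × [0, 1]`. -/
def closedStrip : Set (ℝ × ℝ) := {p | 0 ≤ p.2 ∧ p.2 ≤ 1}

end

/-! Across each line the vertical velocity jumps downwards as `y` increases, since `|H| ≥ H ≥ -|H|`.
The Filippov set is therefore the explicit segment `{G p} × [lowerVelocity H p, upperVelocity H p]`
(`mem_filippovSet_stripField_iff`), and these bounds are one-sided Lipschitz in the sense of
`upperVelocity_sub_lowerVelocity_le`: for `p` above `q`, velocities at `p` exceed those at `q` by at
most `|H p - H q|`.

Uniqueness, invariance and sliding all come from one Gronwall argument for absolutely continuous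
functions, `nonpos_of_ae_deriv_le_mul`. It is applied to the squared distance of two solutions, to
the excursion outside the strip, and to the distance from the line along which the solution should
slide. The a.e. velocity on the lines is separate: a derivative vanishes at almost every point of a
level set.

For existence, the field is replaced by locally Lipschitz fields with a restoring term of strength
`n` outside the strip. Their solutions share one time interval and one Lipschitz constant; a limit
along an ultrafilter is again Lipschitz, and its derivatives fall in the Filippov segment because
the segment's end points bound the approximating velocities in the joint limit `n → ∞`, `q → p`.
Continuation past every compact interval and uniqueness then give the maximal solution on a
half-open interval. -/

open Filter Topology

/-! ### Absolutely continuous functions: Gronwall, Lipschitz bounds, level sets -/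

theorem LipschitzWith.comp_absolutelyContinuousOnInterval {X Y : Type*} [PseudoMetricSpace X]
    [PseudoMetricSpace Y] {K : NNReal} {g : X → Y} (hg : LipschitzWith K g) {f : ℝ → X} {a b : ℝ}
    (hf : AbsolutelyContinuousOnInterval f a b) :
    AbsolutelyContinuousOnInterval (fun t => g (f t)) a b := by
  unfold AbsolutelyContinuousOnInterval at hf ⊢
  refine squeeze_zero (fun t => Finset.sum_nonneg fun i _ => dist_nonneg) (fun t => ?_)
    (by simpa using hf.const_mul (K : ℝ))
  rw [Finset.mul_sum]
  exact Finset.sum_le_sum fun i _ => hg.dist_le_mul _ _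

theorem AbsolutelyContinuousOnInterval.congr {X : Type*} [PseudoMetricSpace X]
    {f g : ℝ → X} {a b : ℝ} (hf : AbsolutelyContinuousOnInterval f a b)
    (h : EqOn f g (uIcc a b)) : AbsolutelyContinuousOnInterval g a b := by
  rw [absolutelyContinuousOnInterval_iff] at hf ⊢
  intro ε hε
  obtain ⟨δ, hδ, H⟩ := hf ε hε
  refine ⟨δ, hδ, fun E hE hl => ?_⟩
  convert! H E hE hl using 2 with i hi
  · rw [h (hE.1 i hi).1, h (hE.1 i hi).2]

/-- An absolutely continuous function which starts nonpositive and satisfies `f' ≤ K f` at almost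
every time where it is positive stays nonpositive. -/
theorem AbsolutelyContinuousOnInterval.nonpos_of_ae_deriv_le_mul {f : ℝ → ℝ} {a b K : ℝ}
    (hab : a ≤ b) (hf : AbsolutelyContinuousOnInterval f a b) (ha : f a ≤ 0)
    (hd : ∀ᵐ t, t ∈ Ioo a b → 0 < f t → ∃ d, HasDerivAt f d t ∧ d ≤ K * f t) : f b ≤ 0 := by
  by_contra! hb
  have hfc : ContinuousOn f (Icc a b) := by simpa [uIcc_of_le hab] using hf.continuousOn
  -- `sSup S` is the last time at which `f ≤ 0`. After it the differential inequality is available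
  -- almost everywhere, so `exp (-K t) f t` cannot increase.
  set S : Set ℝ := Icc a b ∩ f ⁻¹' Iic 0 with hS
  have hSc : IsClosed S := hfc.preimage_isClosed_of_isClosed isClosed_Icc isClosed_Iic
  have hSb : BddAbove S := ⟨b, fun t ht => ht.1.2⟩
  have hSn : S.Nonempty := ⟨a, ⟨le_rfl, hab⟩, ha⟩
  obtain ⟨⟨har, hrb⟩, hfr⟩ := hSc.csSup_mem hSn hSb
  set r := sSup S with hr
  have hpos : ∀ t ∈ Ioc r b, 0 < f t := fun t ht => by
    by_contra! h
    exact absurd (le_csSup hSb (show t ∈ S from ⟨⟨har.trans ht.1.le, ht.2⟩, h⟩)) (not_le.2 ht.1)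
  have hexp : AbsolutelyContinuousOnInterval (fun t => Real.exp (-K * t)) r b :=
    ContDiffOn.absolutelyContinuousOnInterval (by fun_prop)
  have hg := hexp.fun_mul (hf.mono (c := r) (d := b) (by
    rw [uIcc_of_le hab, uIcc_of_le hrb]; exact Icc_subset_Icc_left har))
  have hint := hg.integral_deriv_eq_sub
  have hle : ∫ t in r..b, deriv (fun t => Real.exp (-K * t) * f t) t ≤ 0 := by
    have : ∫ t in r..b, deriv (fun t => Real.exp (-K * t) * f t) t ≤ ∫ t in r..b, (0 : ℝ) := by
      refine intervalIntegral.integral_mono_ae_restrict hrb hg.intervalIntegrable_deriv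
        (by simp) ?_
      rw [EventuallyLE, ae_restrict_iff' measurableSet_Icc]
      filter_upwards [hd, compl_mem_ae_iff.2 (measure_singleton r),
        compl_mem_ae_iff.2 (measure_singleton b)] with t ht htr htb hmem
      have h1 : r < t := lt_of_le_of_ne hmem.1 (Ne.symm htr)
      have h2 : t < b := lt_of_le_of_ne hmem.2 htb
      obtain ⟨d, hd1, hd2⟩ := ht ⟨har.trans_lt h1, h2⟩ (hpos t ⟨h1, hmem.2⟩)
      have he : HasDerivAt (fun t => Real.exp (-K * t)) (Real.exp (-K * t) * (-K)) t := by
        simpa using ((hasDerivAt_id t).const_mul (-K)).exp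
      rw [(he.fun_mul hd1).deriv]
      have := Real.exp_pos (-K * t)
      nlinarith
    simpa using this
  rw [hint] at hle
  have h1 : Real.exp (-K * r) * f r ≤ 0 :=
    mul_nonpos_of_nonneg_of_nonpos (Real.exp_pos _).le hfr
  have h2 := mul_pos (Real.exp_pos (-K * b)) hb
  linarith

theorem AbsolutelyContinuousOnInterval.lipschitzOnWith_of_ae_hasDerivAt {f : ℝ → ℝ} {a b : ℝ}
    {M : NNReal} (hab : a ≤ b) (hf : AbsolutelyContinuousOnInterval f a b)
    (hd : ∀ᵐ t, t ∈ Ioo a b → ∃ d, HasDerivAt f d t ∧ |d| ≤ M) :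
    LipschitzOnWith M f (Icc a b) := by
  refine LipschitzOnWith.of_dist_le_mul fun s hs t ht => ?_
  have hsub : uIcc s t ⊆ Icc a b := uIcc_subset_Icc hs ht
  rw [dist_comm, Real.dist_eq, dist_comm, Real.dist_eq,
    ← (hf.mono (by rwa [uIcc_of_le hab])).integral_deriv_eq_sub]
  refine intervalIntegral.norm_integral_le_of_norm_le_const_ae (f := deriv f) ?_
  filter_upwards [hd, compl_mem_ae_iff.2 (measure_singleton a),
    compl_mem_ae_iff.2 (measure_singleton b)] with r hr hra hrb hmem
  have h := hsub (uIoc_subset_uIcc hmem)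
  obtain ⟨d, h1, h2⟩ := hr ⟨lt_of_le_of_ne h.1 (Ne.symm hra), lt_of_le_of_ne h.2 hrb⟩
  rwa [h1.deriv]

/-- At almost every point of a level set, any derivative vanishes. -/
theorem ae_hasDerivAt_eq_zero_of_level (f : ℝ → ℝ) (c : ℝ) :
    ∀ᵐ t, f t = c → ∀ d, HasDerivAt f d t → d = 0 := by
  -- Only countably many points of the level set are isolated in it from the right; at every other
  -- point the difference quotients along the level set are zero.
  have hcount : {t ∈ f ⁻¹' {c} | 𝓝[f ⁻¹' {c} ∩ Ioi t] t = ⊥}.Countable :=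
    countable_setOfPred_isolated_right_within
  filter_upwards [compl_mem_ae_iff.2 (hcount.measure_zero volume)] with t ht hft d hd
  have hne : (𝓝[f ⁻¹' {c} ∩ Ioi t] t).NeBot := by
    rw [neBot_iff]
    intro h
    exact ht ⟨hft, h⟩
  have hs := (hasDerivAt_iff_tendsto_slope.1 hd).mono_left
    (nhdsWithin_mono t (show f ⁻¹' {c} ∩ Ioi t ⊆ {t}ᶜ from fun s hs => ne_of_gt hs.2))
  have h0 : Tendsto (slope f t) (𝓝[f ⁻¹' {c} ∩ Ioi t] t) (𝓝 0) := by
    refine tendsto_const_nhds.congr' ?_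
    filter_upwards [self_mem_nhdsWithin] with s hs
    have : f s = c := hs.1
    simp [slope_def_field, this, hft]
  exact tendsto_nhds_unique hs h0

theorem HasDerivAt.fst' {w : ℝ → ℝ × ℝ} {v : ℝ × ℝ} {t : ℝ} (h : HasDerivAt w v t) :
    HasDerivAt (fun t => (w t).1) v.1 t := by
  exact (hasFDerivAt_fst (p := w t)).comp_hasDerivAt t h

theorem HasDerivAt.snd' {w : ℝ → ℝ × ℝ} {v : ℝ × ℝ} {t : ℝ} (h : HasDerivAt w v t) :
    HasDerivAt (fun t => (w t).2) v.2 t := by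
  exact (hasFDerivAt_snd (p := w t)).comp_hasDerivAt t h

/-! ### The Filippov set of the strip field -/

noncomputable section

/-- The least vertical velocity allowed by the Filippov regularization of `stripField`. -/
def lowerVelocity (H : ℝ × ℝ → ℝ) (p : ℝ × ℝ) : ℝ :=
  if p.2 < 0 then |H p| else if p.2 < 1 then H p else -|H p|

/-- The greatest vertical velocity allowed by the Filippov regularization of `stripField`. -/
def upperVelocity (H : ℝ × ℝ → ℝ) (p : ℝ × ℝ) : ℝ :=
  if p.2 ≤ 0 then |H p| else if p.2 ≤ 1 then H p else -|H p|

end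

theorem neg_abs_le_lowerVelocity (H : ℝ × ℝ → ℝ) (p : ℝ × ℝ) : -|H p| ≤ lowerVelocity H p := by
  unfold lowerVelocity
  split_ifs <;> linarith [abs_nonneg (H p), neg_abs_le (H p)]

theorem upperVelocity_le_abs (H : ℝ × ℝ → ℝ) (p : ℝ × ℝ) : upperVelocity H p ≤ |H p| := by
  unfold upperVelocity
  split_ifs <;> linarith [abs_nonneg (H p), le_abs_self (H p)]

theorem le_lowerVelocity_of_lt_one {H : ℝ × ℝ → ℝ} {p : ℝ × ℝ} (hp : p.2 < 1) :
    H p ≤ lowerVelocity H p := by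
  unfold lowerVelocity
  split_ifs <;> linarith [le_abs_self (H p)]

theorem upperVelocity_le_of_pos {H : ℝ × ℝ → ℝ} {p : ℝ × ℝ} (hp : 0 < p.2) :
    upperVelocity H p ≤ H p := by
  unfold upperVelocity
  split_ifs <;> linarith [neg_abs_le (H p)]

theorem upperVelocity_nonpos_of_one_lt {H : ℝ × ℝ → ℝ} {p : ℝ × ℝ} (hp : 1 < p.2) :
    upperVelocity H p ≤ 0 := by
  unfold upperVelocity
  split_ifs <;> linarith [abs_nonneg (H p)]

theorem lowerVelocity_nonneg_of_neg {H : ℝ × ℝ → ℝ} {p : ℝ × ℝ} (hp : p.2 < 0) :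
    0 ≤ lowerVelocity H p := by
  unfold lowerVelocity
  split_ifs; exact abs_nonneg (H p)

/-- The one-sided Lipschitz property of the vertical velocity. -/
theorem upperVelocity_sub_lowerVelocity_le (H : ℝ × ℝ → ℝ) {p q : ℝ × ℝ} (h : q.2 < p.2) :
    upperVelocity H p - lowerVelocity H q ≤ |H p - H q| := by
  have h1 := le_abs_self (H p - H q)
  have h2 := abs_sub_abs_le_abs_sub (H p) (H q)
  have h3 := abs_sub_abs_le_abs_sub (H q) (H p)
  rw [abs_sub_comm] at h3
  have h4 := neg_abs_le (H q)
  have h5 := le_abs_self (H q)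
  have h6 := neg_abs_le (H p)
  have h7 := le_abs_self (H p)
  unfold upperVelocity lowerVelocity
  split_ifs <;> linarith

theorem lowerVelocity_le_snd_stripField (G H : ℝ × ℝ → ℝ) (p : ℝ × ℝ) :
    lowerVelocity H p ≤ (stripField G H p).2 := by
  have h4 := neg_abs_le (H p)
  have h5 := le_abs_self (H p)
  unfold lowerVelocity stripField
  dsimp only
  split_ifs <;> linarith

theorem snd_stripField_le_upperVelocity (G H : ℝ × ℝ → ℝ) (p : ℝ × ℝ) :
    (stripField G H p).2 ≤ upperVelocity H p := by
  have h4 := neg_abs_le (H p)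
  have h5 := le_abs_self (H p)
  unfold upperVelocity stripField
  dsimp only
  split_ifs <;> linarith

/-- The reflection `y ↦ 1 - y`, `H ↦ -H` exchanges the two bounds, so each statement about one
transfers to the other. -/
theorem lowerVelocity_eq_neg (H : ℝ × ℝ → ℝ) (p : ℝ × ℝ) :
    lowerVelocity H p = -upperVelocity (fun q => -H (q.1, 1 - q.2)) (p.1, 1 - p.2) := by
  unfold lowerVelocity upperVelocity
  simp only [sub_sub_cancel, abs_neg]
  split_ifs <;> first | rfl | linarith

/-- Upper semicontinuity: on each line the bound takes the larger value, the one from below, so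
nearby values can only drop. -/
theorem eventually_upperVelocity_lt {H : ℝ × ℝ → ℝ} (hH : Continuous H) (p : ℝ × ℝ) {c : ℝ}
    (hc : upperVelocity H p < c) : ∀ᶠ q in 𝓝 p, upperVelocity H q < c := by
  have hA : Tendsto (fun q => |H q|) (𝓝 p) (𝓝 |H p|) := (hH.abs.tendsto p)
  have hB := hH.tendsto p
  unfold upperVelocity at hc
  split_ifs at hc with h0 h1
  · filter_upwards [hA.eventually_lt_const hc] with q hq
    exact (upperVelocity_le_abs H q).trans_lt hq
  · filter_upwards [hB.eventually_lt_const hc,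
      (continuous_snd.tendsto p).eventually_const_lt (not_le.1 h0)] with q hq hq0
    exact (upperVelocity_le_of_pos hq0).trans_lt hq
  · filter_upwards [hA.neg.eventually_lt_const hc,
      (continuous_snd.tendsto p).eventually_const_lt (not_le.1 h1)] with q hq hq1
    rw [upperVelocity, if_neg (by linarith), if_neg (by linarith)]
    exact hq

theorem eventually_lt_lowerVelocity {H : ℝ × ℝ → ℝ} (hH : Continuous H) (p : ℝ × ℝ) {c : ℝ}
    (hc : c < lowerVelocity H p) : ∀ᶠ q in 𝓝 p, c < lowerVelocity H q := by
  rw [lowerVelocity_eq_neg] at hc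
  have hH' : Continuous fun q : ℝ × ℝ => -H (q.1, 1 - q.2) := by fun_prop
  have h := eventually_upperVelocity_lt hH' (p.1, 1 - p.2) (c := -c) (by linarith)
  have hφ : Continuous fun q : ℝ × ℝ => (q.1, 1 - q.2) := by fun_prop
  filter_upwards [hφ.tendsto p |>.eventually h] with q hq
  rw [lowerVelocity_eq_neg]
  linarith

/-- By semicontinuity of the bounds, the field maps a small ball into a closed box, which is convex;
`N = ∅` suffices here. -/
theorem filippovSet_stripField_subset {G H : ℝ × ℝ → ℝ} (hG : Continuous G) (hH : Continuous H)
    {p v : ℝ × ℝ} (hv : v ∈ filippovSet (stripField G H) p) :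
    v.1 = G p ∧ lowerVelocity H p ≤ v.2 ∧ v.2 ≤ upperVelocity H p := by
  have key : ∀ ε > 0, v ∈ Icc (G p - ε) (G p + ε) ×ˢ
      Icc (lowerVelocity H p - ε) (upperVelocity H p + ε) := by
    intro ε hε
    have h1 := (hG.tendsto p).eventually (Icc_mem_nhds (sub_lt_self (G p) hε)
      (lt_add_of_pos_right (G p) hε))
    have h2 := eventually_upperVelocity_lt hH p (lt_add_of_pos_right _ hε)
    have h3 := eventually_lt_lowerVelocity hH p (sub_lt_self _ hε)
    obtain ⟨δ, hδ, hball⟩ := Metric.eventually_nhds_iff_ball.1 (h1.and (h2.and h3))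
    have hv' := mem_iInter₂.1 (mem_iInter₂.1 hv δ hδ) ∅ measure_empty
    refine closure_minimal (convexHull_min ?_ ((convex_Icc _ _).prod (convex_Icc _ _)))
      (isClosed_Icc.prod isClosed_Icc) hv'
    rintro _ ⟨q, ⟨hq, -⟩, rfl⟩
    obtain ⟨g1, g2, g3⟩ := hball q hq
    exact ⟨g1, g3.le.trans (lowerVelocity_le_snd_stripField G H q),
      (snd_stripField_le_upperVelocity G H q).trans g2.le⟩
  refine ⟨?_, ?_, ?_⟩
  · apply le_antisymm
    · exact le_of_forall_pos_le_add fun ε hε => (key ε hε).1.2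
    · exact le_of_forall_pos_le_add fun ε hε => by linarith [(key ε hε).1.1]
  · exact le_of_forall_pos_le_add fun ε hε => by linarith [(key ε hε).2.1]
  · exact le_of_forall_pos_le_add fun ε hε => (key ε hε).2.2

/-- A limit of a field along an open set lies in the closure of its values off any null set. -/
theorem mem_closure_image_ball_diff_null {f g : ℝ × ℝ → ℝ × ℝ} {U : Set (ℝ × ℝ)} {p : ℝ × ℝ}
    (hU : IsOpen U) (hp : p ∈ closure U) (hg : Continuous g) (hfg : EqOn f g U) {δ : ℝ}
    (hδ : 0 < δ) {N : Set (ℝ × ℝ)} (hN : volume N = 0) :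
    g p ∈ closure (f '' (Metric.ball p δ \ N)) := by
  rw [mem_closure_iff_nhds]
  intro V hV
  have hW : interior (g ⁻¹' V) ∩ Metric.ball p δ ∈ 𝓝 p :=
    inter_mem (interior_mem_nhds.2 (hg.continuousAt hV)) (Metric.ball_mem_nhds p hδ)
  obtain ⟨q, hq⟩ := mem_closure_iff_nhds.1 hp _ hW
  have hopen : IsOpen (interior (g ⁻¹' V) ∩ Metric.ball p δ ∩ U) :=
    (isOpen_interior.inter Metric.isOpen_ball).inter hU
  have hpos := hopen.measure_pos volume ⟨q, hq⟩
  obtain ⟨r, hr, hrN⟩ : ((interior (g ⁻¹' V) ∩ Metric.ball p δ ∩ U) \ N).Nonempty := by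
    rw [nonempty_iff_ne_empty]
    intro h
    exact hpos.ne' (measure_mono_null (sdiff_eq_empty.1 h) hN)
  refine ⟨f r, ?_, r, ⟨hr.1.2, hrN⟩, rfl⟩
  rw [hfg hr.2]
  exact (interior_subset hr.1.1 : r ∈ g ⁻¹' V)

theorem mem_closure_snd_preimage {V : Set ℝ} {p : ℝ × ℝ} (h : p.2 ∈ closure V) :
    p ∈ closure {q : ℝ × ℝ | q.2 ∈ V} := by
  have : {q : ℝ × ℝ | q.2 ∈ V} = univ ×ˢ V := by ext; simp
  rw [this, closure_prod_eq]
  exact ⟨by simp, h⟩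

/-- The bound is the limit of the field from an adjacent open region, which meets every ball around
`p` in positive measure; removing a null set cannot destroy it. On a line, the region below is used.
-/
theorem upperVelocity_mem_closure {G H : ℝ × ℝ → ℝ} (hG : Continuous G) (hH : Continuous H)
    (p : ℝ × ℝ) {δ : ℝ} (hδ : 0 < δ) {N : Set (ℝ × ℝ)} (hN : volume N = 0) :
    (G p, upperVelocity H p) ∈ closure (stripField G H '' (Metric.ball p δ \ N)) := by
  unfold upperVelocity
  split_ifs with h0 h1
  · refine mem_closure_image_ball_diff_null (U := {q | q.2 ∈ Iio 0}) (g := fun q => (G q, |H q|))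
      (isOpen_Iio.preimage continuous_snd) (mem_closure_snd_preimage (by simpa))
      (by fun_prop) (fun q hq => ?_) hδ hN
    have hq : q.2 < 0 := hq
    simp only [stripField]
    rw [if_neg (by linarith), if_neg (by linarith), if_neg (by linarith), if_neg (by linarith)]
  · refine mem_closure_image_ball_diff_null (U := {q | q.2 ∈ Ioo 0 1}) (g := fun q => (G q, H q))
      (isOpen_Ioo.preimage continuous_snd) (mem_closure_snd_preimage ?_)
      (by fun_prop) (fun q hq => ?_) hδ hN
    · rw [closure_Ioo (by norm_num)]
      exact ⟨(not_le.1 h0).le, h1⟩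
    have hq : 0 < q.2 ∧ q.2 < 1 := hq
    simp only [stripField]
    rw [if_neg (by linarith), if_neg (by linarith), if_pos (by linarith)]
  · refine mem_closure_image_ball_diff_null (U := {q | q.2 ∈ Ioi 1}) (g := fun q => (G q, -|H q|))
      (isOpen_Ioi.preimage continuous_snd) (mem_closure_snd_preimage ?_)
      (by fun_prop) (fun q hq => ?_) hδ hN
    · exact subset_closure (not_le.1 h1)
    have hq : 1 < q.2 := hq
    simp only [stripField]
    rw [if_pos hq]

theorem lowerVelocity_mem_closure {G H : ℝ × ℝ → ℝ} (hG : Continuous G) (hH : Continuous H)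
    (p : ℝ × ℝ) {δ : ℝ} (hδ : 0 < δ) {N : Set (ℝ × ℝ)} (hN : volume N = 0) :
    (G p, lowerVelocity H p) ∈ closure (stripField G H '' (Metric.ball p δ \ N)) := by
  unfold lowerVelocity
  split_ifs with h0 h1
  · refine mem_closure_image_ball_diff_null (U := {q | q.2 ∈ Iio 0}) (g := fun q => (G q, |H q|))
      (isOpen_Iio.preimage continuous_snd) (mem_closure_snd_preimage (by simpa using h0.le))
      (by fun_prop) (fun q hq => ?_) hδ hN
    have hq : q.2 < 0 := hq
    simp only [stripField]
    rw [if_neg (by linarith), if_neg (by linarith), if_neg (by linarith), if_neg (by linarith)]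
  · refine mem_closure_image_ball_diff_null (U := {q | q.2 ∈ Ioo 0 1}) (g := fun q => (G q, H q))
      (isOpen_Ioo.preimage continuous_snd) (mem_closure_snd_preimage ?_)
      (by fun_prop) (fun q hq => ?_) hδ hN
    · rw [closure_Ioo (by norm_num)]
      exact ⟨not_lt.1 h0, h1.le⟩
    have hq : 0 < q.2 ∧ q.2 < 1 := hq
    simp only [stripField]
    rw [if_neg (by linarith), if_neg (by linarith), if_pos (by linarith)]
  · refine mem_closure_image_ball_diff_null (U := {q | q.2 ∈ Ioi 1}) (g := fun q => (G q, -|H q|))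
      (isOpen_Ioi.preimage continuous_snd) (mem_closure_snd_preimage ?_)
      (by fun_prop) (fun q hq => ?_) hδ hN
    · rw [closure_Ioi]; exact not_lt.1 h1
    have hq : 1 < q.2 := hq
    simp only [stripField]
    rw [if_pos hq]

theorem mem_filippovSet_stripField_iff {G H : ℝ × ℝ → ℝ} (hG : Continuous G) (hH : Continuous H)
    {p v : ℝ × ℝ} : v ∈ filippovSet (stripField G H) p ↔
      v.1 = G p ∧ lowerVelocity H p ≤ v.2 ∧ v.2 ≤ upperVelocity H p := by
  refine ⟨filippovSet_stripField_subset hG hH, fun ⟨h1, h2, h3⟩ => ?_⟩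
  simp only [filippovSet, mem_iInter]
  intro δ hδ N hN
  have hlo := closure_mono (subset_convexHull ℝ _) (lowerVelocity_mem_closure hG hH p hδ hN)
  have hhi := closure_mono (subset_convexHull ℝ _) (upperVelocity_mem_closure hG hH p hδ hN)
  refine (convex_convexHull ℝ _).closure.segment_subset hlo hhi ?_
  have : v = (G p, v.2) := Prod.ext h1 rfl
  rw [this, ← Prod.image_mk_segment_right, segment_eq_Icc (h2.trans h3)]
  exact ⟨v.2, ⟨h2, h3⟩, rfl⟩

/-! ### Invariance, sliding and uniqueness -/

theorem ContDiff.exists_lipschitzOnWith_of_isCompact {f : ℝ × ℝ → ℝ} {S : Set (ℝ × ℝ)}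
    (hf : ContDiff ℝ 1 f) (hS : IsCompact S) : ∃ L : NNReal, LipschitzOnWith L f S :=
  hf.locallyLipschitz.locallyLipschitzOn.exists_lipschitzOnWith_of_compact hS

namespace IsFilippovSolution

variable {G H : ℝ × ℝ → ℝ} {f : ℝ × ℝ → ℝ × ℝ} {J : Set ℝ} {w z : ℝ → ℝ × ℝ} {s t : ℝ}

theorem mono {J' : Set ℝ} (hw : IsFilippovSolution f J w) (hJ : J'.OrdConnected) (h : J' ⊆ J) :
    IsFilippovSolution f J' w where
  ordConnected := hJ
  absolutelyContinuous a ha b hb hab := hw.absolutelyContinuous a (h ha) b (h hb) hab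
  ae_hasDerivAt := by
    filter_upwards [hw.ae_hasDerivAt] with t ht hmem using ht (interior_mono h hmem)

theorem restrict_Icc (hw : IsFilippovSolution f J w) (hs : s ∈ J) (ht : t ∈ J) :
    IsFilippovSolution f (Icc s t) w :=
  hw.mono ordConnected_Icc (hw.ordConnected.out hs ht)

theorem continuousOn_Icc (hw : IsFilippovSolution f J w) (hs : s ∈ J) (ht : t ∈ J) (hst : s ≤ t) :
    ContinuousOn w (Icc s t) := by
  simpa [uIcc_of_le hst] using (hw.absolutelyContinuous s hs t ht hst).continuousOn

theorem absolutelyContinuous_fst (hw : IsFilippovSolution f J w) (hs : s ∈ J) (ht : t ∈ J)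
    (hst : s ≤ t) : AbsolutelyContinuousOnInterval (fun r => (w r).1) s t :=
  LipschitzWith.prod_fst.comp_absolutelyContinuousOnInterval
    (hw.absolutelyContinuous s hs t ht hst)

theorem absolutelyContinuous_snd (hw : IsFilippovSolution f J w) (hs : s ∈ J) (ht : t ∈ J)
    (hst : s ≤ t) : AbsolutelyContinuousOnInterval (fun r => (w r).2) s t :=
  LipschitzWith.prod_snd.comp_absolutelyContinuousOnInterval
    (hw.absolutelyContinuous s hs t ht hst)

theorem congr (hw : IsFilippovSolution f J w) (h : EqOn w z J) : IsFilippovSolution f J z where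
  ordConnected := hw.ordConnected
  absolutelyContinuous a ha b hb hab := (hw.absolutelyContinuous a ha b hb hab).congr
    (h.mono (hw.ordConnected.uIcc_subset ha hb))
  ae_hasDerivAt := by
    filter_upwards [hw.ae_hasDerivAt] with t ht hmem
    obtain ⟨v, hv, hd⟩ := ht hmem
    rw [h (interior_subset hmem)] at hv
    refine ⟨v, hv, hd.congr_of_eventuallyEq ?_⟩
    filter_upwards [mem_interior_iff_mem_nhds.1 hmem] with r hr using (h hr).symm

theorem ae_velocity (hw : IsFilippovSolution (stripField G H) J w) (hG : Continuous G)
    (hH : Continuous H) : ∀ᵐ t : ℝ, t ∈ interior J → ∃ v, HasDerivAt w v t ∧ v.1 = G (w t) ∧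
      lowerVelocity H (w t) ≤ v.2 ∧ v.2 ≤ upperVelocity H (w t) := by
  filter_upwards [hw.ae_hasDerivAt] with t ht hmem
  obtain ⟨v, hv, hd⟩ := ht hmem
  exact ⟨v, hd, (mem_filippovSet_stripField_iff hG hH).1 hv⟩

theorem ae_velocity_Ioo (hw : IsFilippovSolution (stripField G H) J w) (hG : Continuous G)
    (hH : Continuous H) (hs : s ∈ J) (ht : t ∈ J) :
    ∀ᵐ r : ℝ, r ∈ Ioo s t → ∃ v, HasDerivAt w v r ∧ v.1 = G (w r) ∧
      lowerVelocity H (w r) ≤ v.2 ∧ v.2 ≤ upperVelocity H (w r) := by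
  simpa using (hw.restrict_Icc hs ht).ae_velocity hG hH

theorem snd_le_one (hw : IsFilippovSolution (stripField G H) J w) (hG : Continuous G)
    (hH : Continuous H) (hs : s ∈ J) (ht : t ∈ J) (hst : s ≤ t) (h : (w s).2 ≤ 1) :
    (w t).2 ≤ 1 := by
  have hac := (hw.absolutelyContinuous_snd hs ht hst).fun_sub
    (ContDiffOn.absolutelyContinuousOnInterval (f := fun _ => (1 : ℝ)) contDiffOn_const)
  have := hac.nonpos_of_ae_deriv_le_mul (K := 0) hst (by linarith) (by
    filter_upwards [hw.ae_velocity_Ioo hG hH hs ht] with r hr hmem hpos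
    obtain ⟨v, hd, -, -, hv⟩ := hr hmem
    refine ⟨v.2, hd.snd'.sub_const 1, ?_⟩
    linarith [upperVelocity_nonpos_of_one_lt (H := H) (p := w r) (by linarith)])
  linarith

theorem snd_nonneg (hw : IsFilippovSolution (stripField G H) J w) (hG : Continuous G)
    (hH : Continuous H) (hs : s ∈ J) (ht : t ∈ J) (hst : s ≤ t) (h : 0 ≤ (w s).2) :
    0 ≤ (w t).2 := by
  have hac := (hw.absolutelyContinuous_snd hs ht hst).fun_neg
  have := hac.nonpos_of_ae_deriv_le_mul (K := 0) hst (by linarith) (by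
    filter_upwards [hw.ae_velocity_Ioo hG hH hs ht] with r hr hmem hpos
    obtain ⟨v, hd, -, hv, -⟩ := hr hmem
    refine ⟨-v.2, hd.snd'.fun_neg, ?_⟩
    linarith [lowerVelocity_nonneg_of_neg (H := H) (p := w r) (by linarith)])
  linarith

theorem ae_hasDerivAt_of_mem_lines (hw : IsFilippovSolution (stripField G H) J w)
    (hG : Continuous G) (hH : Continuous H) :
    ∀ᵐ t : ℝ, t ∈ interior J → ((w t).2 = 0 ∨ (w t).2 = 1) → HasDerivAt w (G (w t), 0) t := by
  filter_upwards [hw.ae_velocity hG hH, ae_hasDerivAt_eq_zero_of_level (fun t => (w t).2) 0,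
    ae_hasDerivAt_eq_zero_of_level (fun t => (w t).2) 1] with t ht h0 h1 hmem hline
  obtain ⟨v, hd, hv, -⟩ := ht hmem
  have hv2 : v.2 = 0 := hline.elim (fun h => h0 h _ hd.snd') (fun h => h1 h _ hd.snd')
  rwa [← hv, ← hv2]

/-- Below the line the vertical velocity is at least `H (x, y) ≥ H (x, 1) - L (1 - y) ≥ -L (1 - y)`,
so Gronwall keeps `1 - y` from becoming positive. -/
theorem snd_eq_one_of_nonneg (hw : IsFilippovSolution (stripField G H) J w) (hG : Continuous G)
    (hH : ContDiff ℝ 1 H) (hs : s ∈ J) (ht : t ∈ J) (hst : s ≤ t) (h : (w s).2 = 1)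
    (hpos : ∀ r ∈ Icc s t, 0 ≤ H ((w r).1, 1)) : (w t).2 = 1 := by
  refine le_antisymm (hw.snd_le_one hG hH.continuous hs ht hst h.le) ?_
  have hc := hw.continuousOn_Icc hs ht hst
  -- `H` is compared at a point of the trajectory and at its projection to the line, so the compact
  -- set contains both curves.
  obtain ⟨L, hL⟩ := hH.exists_lipschitzOnWith_of_isCompact
    ((isCompact_Icc.image_of_continuousOn hc).union
    (isCompact_Icc.image_of_continuousOn (hc.fst.prodMk (continuousOn_const (c := (1 : ℝ))))))
  have hac := (ContDiffOn.absolutelyContinuousOnInterval (f := fun _ => (1 : ℝ))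
    contDiffOn_const).fun_sub (hw.absolutelyContinuous_snd hs ht hst)
  have := hac.nonpos_of_ae_deriv_le_mul (K := L) hst (by linarith) (by
    filter_upwards [hw.ae_velocity_Ioo hG hH.continuous hs ht] with r hr hmem hlt
    obtain ⟨v, hd, -, hv, -⟩ := hr hmem
    refine ⟨-v.2, hd.snd'.const_sub 1, ?_⟩
    have hmem' := Ioo_subset_Icc_self hmem
    have h1 := hL.dist_le_mul _ (Or.inl ⟨r, hmem', rfl⟩) _ (Or.inr ⟨r, hmem', rfl⟩)
    rw [Real.dist_eq, Prod.dist_eq, dist_self, Real.dist_eq, max_eq_right (abs_nonneg _),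
      abs_sub_comm (w r).2, abs_of_pos hlt, abs_le] at h1
    linarith [hpos r hmem', le_lowerVelocity_of_lt_one (H := H) (p := w r) (by linarith)])
  linarith

theorem snd_eq_zero_of_nonpos (hw : IsFilippovSolution (stripField G H) J w) (hG : Continuous G)
    (hH : ContDiff ℝ 1 H) (hs : s ∈ J) (ht : t ∈ J) (hst : s ≤ t) (h : (w s).2 = 0)
    (hneg : ∀ r ∈ Icc s t, H ((w r).1, 0) ≤ 0) : (w t).2 = 0 := by
  refine le_antisymm ?_ (hw.snd_nonneg hG hH.continuous hs ht hst h.ge)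
  have hc := hw.continuousOn_Icc hs ht hst
  obtain ⟨L, hL⟩ := hH.exists_lipschitzOnWith_of_isCompact
    ((isCompact_Icc.image_of_continuousOn hc).union
    (isCompact_Icc.image_of_continuousOn (hc.fst.prodMk (continuousOn_const (c := (0 : ℝ))))))
  refine (hw.absolutelyContinuous_snd hs ht hst).nonpos_of_ae_deriv_le_mul (K := L) hst h.le ?_
  filter_upwards [hw.ae_velocity_Ioo hG hH.continuous hs ht] with r hr hmem hlt
  obtain ⟨v, hd, -, -, hv⟩ := hr hmem
  refine ⟨v.2, hd.snd', ?_⟩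
  have hmem' := Ioo_subset_Icc_self hmem
  have h1 := hL.dist_le_mul _ (Or.inl ⟨r, hmem', rfl⟩) _ (Or.inr ⟨r, hmem', rfl⟩)
  rw [Real.dist_eq, Prod.dist_eq, dist_self, Real.dist_eq, max_eq_right (abs_nonneg _),
    sub_zero, abs_of_pos hlt, abs_le] at h1
  linarith [hneg r hmem', upperVelocity_le_of_pos (H := H) (p := w r) hlt]

/-- The equation `x' = G (w)` holds only almost everywhere, but its right side is continuous, so the
integral form makes it hold at every time. -/
theorem hasDerivWithinAt_of_snd_eq_const (hw : IsFilippovSolution (stripField G H) J w)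
    (hG : Continuous G) (hH : Continuous H) (hs : s ∈ J) (ht : t ∈ J) (hst : s ≤ t) {c : ℝ}
    (hc : ∀ r ∈ Icc s t, (w r).2 = c) {r : ℝ} (hr : r ∈ Icc s t) :
    HasDerivWithinAt w (G (w r), 0) (Icc s t) r := by
  have hcont : ContinuousOn (fun r => G (w r)) (Icc s t) :=
    hG.comp_continuousOn (hw.continuousOn_Icc hs ht hst)
  set g := IccExtend hst ((Icc s t).domRestrict fun r => G (w r)) with hg
  have hgc : Continuous g := hcont.domRestrict.Icc_extend'
  have hgeq : ∀ q ∈ Icc s t, g q = G (w q) := fun q hq => by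
    rw [hg, IccExtend_of_mem _ _ hq]; rfl
  have hx : ∀ q ∈ Icc s t, (w q).1 = (w s).1 + ∫ u in s..q, g u := by
    intro q hq
    have hqJ := hw.ordConnected.out hs ht hq
    have := (hw.absolutelyContinuous_fst hs hqJ hq.1).integral_deriv_eq_sub
    rw [intervalIntegral.integral_congr_ae (g := g)] at this
    · linarith
    · filter_upwards [hw.ae_velocity_Ioo hG hH hs hqJ,
        compl_mem_ae_iff.2 (measure_singleton q)] with u hu huq hmem
      rw [uIoc_of_le hq.1] at hmem
      obtain ⟨v, hd, hv, -⟩ := hu ⟨hmem.1, lt_of_le_of_ne hmem.2 huq⟩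
      rw [hd.fst'.deriv, hv, hgeq u ⟨hmem.1.le, hmem.2.trans hq.2⟩]
  have hd1 : HasDerivWithinAt (fun q => (w q).1) (G (w r)) (Icc s t) r := by
    rw [← hgeq r hr]
    refine HasDerivWithinAt.congr ?_ hx (hx r hr)
    exact ((hgc.integral_hasStrictDerivAt s r).hasDerivAt.const_add _).hasDerivWithinAt
  have hd2 : HasDerivWithinAt (fun q => (w q).2) 0 (Icc s t) r :=
    (hasDerivWithinAt_const r (Icc s t) c).congr hc (hc r hr)
  exact hd1.prodMk hd2

/-- Forward uniqueness, by the one-sided Lipschitz property. -/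
theorem eq_of_eq_left (hG : ContDiff ℝ 1 G) (hH : ContDiff ℝ 1 H) {J' : Set ℝ}
    (hw : IsFilippovSolution (stripField G H) J w) (hz : IsFilippovSolution (stripField G H) J' z)
    (hs : s ∈ J) (ht : t ∈ J) (hs' : s ∈ J') (ht' : t ∈ J') (hst : s ≤ t) (h : w s = z s) :
    w t = z t := by
  have hS := (isCompact_Icc.image_of_continuousOn (hw.continuousOn_Icc hs ht hst)).union
    (isCompact_Icc.image_of_continuousOn (hz.continuousOn_Icc hs' ht' hst))
  obtain ⟨L₁, hL₁⟩ := hG.exists_lipschitzOnWith_of_isCompact hS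
  obtain ⟨L₂, hL₂⟩ := hH.exists_lipschitzOnWith_of_isCompact hS
  have hx := (hw.absolutelyContinuous_fst hs ht hst).fun_sub
    (hz.absolutelyContinuous_fst hs' ht' hst)
  have hy := (hw.absolutelyContinuous_snd hs ht hst).fun_sub
    (hz.absolutelyContinuous_snd hs' ht' hst)
  -- The Euclidean square is used because the sup norm of `ℝ × ℝ` is not differentiable; the sup
  -- distance `m` below, in which the Lipschitz bounds are stated, satisfies `m² ≤` this square.
  have hac := (hx.fun_mul hx).fun_add (hy.fun_mul hy)
  have key := hac.nonpos_of_ae_deriv_le_mul (K := 2 * L₁ + 2 * L₂) hst (by simp [h]) (by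
    filter_upwards [hw.ae_velocity_Ioo hG.continuous hH.continuous hs ht,
      hz.ae_velocity_Ioo hG.continuous hH.continuous hs' ht'] with r hr hr' hmem _
    obtain ⟨v, hd, hv, hvl, hvu⟩ := hr hmem
    obtain ⟨v', hd', hv', hvl', hvu'⟩ := hr' hmem
    have hdx := hd.fst'.fun_sub hd'.fst'
    have hdy := hd.snd'.fun_sub hd'.snd'
    refine ⟨_, (hdx.fun_mul hdx).fun_add (hdy.fun_mul hdy), ?_⟩
    have hmem' := Ioo_subset_Icc_self hmem
    have h1 := hL₁.dist_le_mul _ (Or.inl ⟨r, hmem', rfl⟩) _ (Or.inr ⟨r, hmem', rfl⟩)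
    have h2 := hL₂.dist_le_mul _ (Or.inl ⟨r, hmem', rfl⟩) _ (Or.inr ⟨r, hmem', rfl⟩)
    rw [Real.dist_eq, Prod.dist_eq, Real.dist_eq, Real.dist_eq] at h1 h2
    set m := max |(w r).1 - (z r).1| |(w r).2 - (z r).2| with hm
    have hmx : |(w r).1 - (z r).1| ≤ m := le_max_left _ _
    have hmy : |(w r).2 - (z r).2| ≤ m := le_max_right _ _
    have hm0 : 0 ≤ m := (abs_nonneg _).trans hmx
    have hmsq : m * m ≤ ((w r).1 - (z r).1) * ((w r).1 - (z r).1) +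
        ((w r).2 - (z r).2) * ((w r).2 - (z r).2) := by
      rcases max_choice |(w r).1 - (z r).1| |(w r).2 - (z r).2| with h | h <;>
        rw [hm, h, abs_mul_abs_self]
      · linarith [mul_self_nonneg ((w r).2 - (z r).2)]
      · linarith [mul_self_nonneg ((w r).1 - (z r).1)]
    have hA : ((w r).1 - (z r).1) * (v.1 - v'.1) ≤ m * (L₁ * m) := by
      rw [hv, hv']
      refine (le_abs_self _).trans ?_
      rw [abs_mul]
      exact mul_le_mul hmx h1 (abs_nonneg _) hm0
    have hB : ((w r).2 - (z r).2) * (v.2 - v'.2) ≤ m * (L₂ * m) := by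
      have hLm : 0 ≤ L₂ * m := mul_nonneg L₂.2 hm0
      -- At equal heights the two vertical velocities may differ by a jump, but their difference is
      -- multiplied by zero.
      rcases lt_trichotomy (w r).2 (z r).2 with hlt | heq | hgt
      · have h3 := upperVelocity_sub_lowerVelocity_le H hlt
        rw [abs_sub_comm] at h3
        have h4 : |(w r).2 - (z r).2| = (z r).2 - (w r).2 := by
          rw [abs_sub_comm, abs_of_pos (by linarith)]
        calc ((w r).2 - (z r).2) * (v.2 - v'.2) = ((z r).2 - (w r).2) * (v'.2 - v.2) := by ring
          _ ≤ ((z r).2 - (w r).2) * (L₂ * m) :=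
            mul_le_mul_of_nonneg_left (by linarith) (by linarith)
          _ ≤ m * (L₂ * m) := mul_le_mul_of_nonneg_right (by linarith) hLm
      · rw [heq, sub_self, zero_mul]; exact mul_nonneg hm0 hLm
      · have h3 := upperVelocity_sub_lowerVelocity_le H hgt
        have h4 : |(w r).2 - (z r).2| = (w r).2 - (z r).2 := abs_of_pos (by linarith)
        calc ((w r).2 - (z r).2) * (v.2 - v'.2) ≤ ((w r).2 - (z r).2) * (L₂ * m) :=
            mul_le_mul_of_nonneg_left (by linarith) (by linarith)
          _ ≤ m * (L₂ * m) := mul_le_mul_of_nonneg_right (by linarith) hLm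
    have hK : (0 : ℝ) ≤ 2 * L₁ + 2 * L₂ := by positivity
    have := mul_le_mul_of_nonneg_left hmsq hK
    linarith)
  have h1 := mul_self_nonneg ((w t).1 - (z t).1)
  have h2 := mul_self_nonneg ((w t).2 - (z t).2)
  have h3 := mul_self_eq_zero.1 (le_antisymm (by linarith) h1)
  have h4 := mul_self_eq_zero.1 (le_antisymm (by linarith) h2)
  exact Prod.ext (by linarith) (by linarith)

/-- The admissible velocities are bounded by `|G|` and `|H|`, which are bounded on the compact
trajectory. -/
theorem exists_lipschitzOnWith_Icc (hG : Continuous G) (hH : Continuous H)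
    (hw : IsFilippovSolution (stripField G H) (Icc s t) w) (hst : s ≤ t) :
    ∃ M : NNReal, LipschitzOnWith M w (Icc s t) := by
  have hs := left_mem_Icc.2 hst
  have ht := right_mem_Icc.2 hst
  have hc := hw.continuousOn_Icc hs ht hst
  obtain ⟨M₁, hM₁⟩ := isCompact_Icc.exists_bound_of_continuousOn (hG.comp_continuousOn hc)
  obtain ⟨M₂, hM₂⟩ := isCompact_Icc.exists_bound_of_continuousOn (hH.comp_continuousOn hc)
  refine ⟨_, LipschitzOnWith.prodMk (f := fun r => (w r).1) (g := fun r => (w r).2)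
    ((hw.absolutelyContinuous_fst hs ht hst).lipschitzOnWith_of_ae_hasDerivAt
      (M := M₁.toNNReal) hst ?_)
    ((hw.absolutelyContinuous_snd hs ht hst).lipschitzOnWith_of_ae_hasDerivAt
      (M := M₂.toNNReal) hst ?_)⟩
  · filter_upwards [hw.ae_velocity_Ioo hG hH hs ht] with r hr hmem
    obtain ⟨v, hd, hv, -⟩ := hr hmem
    refine ⟨_, hd.fst', ?_⟩
    rw [hv]
    exact (hM₁ r (Ioo_subset_Icc_self hmem)).trans (Real.le_coe_toNNReal _)
  · filter_upwards [hw.ae_velocity_Ioo hG hH hs ht] with r hr hmem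
    obtain ⟨v, hd, -, hvl, hvu⟩ := hr hmem
    refine ⟨_, hd.snd', ?_⟩
    refine le_trans ?_ ((hM₂ r (Ioo_subset_Icc_self hmem)).trans (Real.le_coe_toNNReal _))
    exact abs_le.2 ⟨(neg_abs_le_lowerVelocity H _).trans hvl,
      hvu.trans (upperVelocity_le_abs H _)⟩

end IsFilippovSolution

/-! ### Locally Lipschitz approximations of the field -/

noncomputable section

/-- A locally Lipschitz approximation of `stripField`, whose vertical component is `H` clipped to
`[-|H|, |H|]` after a strong restoring term is added outside the strip. -/
def regularizedField (G H : ℝ × ℝ → ℝ) (n : ℕ) (q : ℝ × ℝ) : ℝ × ℝ :=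
  (G q, min |H q| (max (-|H q|) (H q + (n * max (-q.2) 0 + (-n) * max (q.2 - 1) 0))))

end

theorem LocallyLipschitz.const_mul_real {f : ℝ × ℝ → ℝ} (hf : LocallyLipschitz f) (c : ℝ) :
    LocallyLipschitz fun p => c * f p :=
  (lipschitzWith_smul (β := ℝ) c).locallyLipschitz.comp hf

theorem locallyLipschitz_regularizedField {G H : ℝ × ℝ → ℝ} (hG : ContDiff ℝ 1 G)
    (hH : ContDiff ℝ 1 H) (n : ℕ) : LocallyLipschitz (regularizedField G H n) := by
  have h1 := hH.locallyLipschitz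
  have h2 : LocallyLipschitz fun q => |H q| := by
    have := h1.max h1.neg
    exact this
  have h3 : LocallyLipschitz fun q : ℝ × ℝ => -q.2 :=
    ContDiff.locallyLipschitz (𝕂 := ℝ) contDiff_snd.neg
  have h4 : LocallyLipschitz fun q : ℝ × ℝ => q.2 - 1 :=
    ContDiff.locallyLipschitz (𝕂 := ℝ) (contDiff_snd.sub contDiff_const)
  exact hG.locallyLipschitz.prodMk (h2.min (h2.neg.max
    (h1.add (((h3.max_const 0).const_mul_real n).add ((h4.max_const 0).const_mul_real (-n))))))

theorem abs_snd_regularizedField_le (G H : ℝ × ℝ → ℝ) (n : ℕ) (q : ℝ × ℝ) :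
    |(regularizedField G H n q).2| ≤ |H q| := by
  simp only [regularizedField]
  refine abs_le.2 ⟨?_, min_le_left _ _⟩
  exact le_min (by linarith [abs_nonneg (H q)]) (le_max_left _ _)

theorem eventually_snd_regularizedField_lt {G H : ℝ × ℝ → ℝ} (hH : Continuous H) (p : ℝ × ℝ)
    {c : ℝ} (hc : upperVelocity H p < c) :
    ∀ᶠ x : ℕ × (ℝ × ℝ) in atTop ×ˢ 𝓝 p, (regularizedField G H x.1 x.2).2 < c := by
  have hq : Tendsto (fun x : ℕ × (ℝ × ℝ) => x.2) (atTop ×ˢ 𝓝 p) (𝓝 p) := tendsto_snd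
  have h1 := hq.eventually (eventually_upperVelocity_lt hH p hc)
  rcases le_or_gt p.2 0 with h0 | h0
  · rw [upperVelocity, if_pos h0] at hc
    filter_upwards [hq.eventually ((hH.abs.tendsto p).eventually_lt_const hc)] with x hx
    exact ((le_abs_self _).trans (abs_snd_regularizedField_le G H _ _)).trans_lt hx
  rcases le_or_gt p.2 1 with h1' | h1'
  · rw [upperVelocity, if_neg (not_le.2 h0), if_pos h1'] at hc
    filter_upwards [hq.eventually ((hH.tendsto p).eventually_lt_const hc),
      hq.eventually ((continuous_snd.tendsto p).eventually_const_lt h0)] with x hx hx0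
    refine lt_of_le_of_lt ((min_le_right _ _).trans (max_le (neg_abs_le _) ?_)) hx
    rw [max_eq_right (a := -x.2.2) (by linarith)]
    have : (0 : ℝ) ≤ x.1 * max (x.2.2 - 1) 0 :=
      mul_nonneg (Nat.cast_nonneg _) (le_max_right _ _)
    linarith
  · rw [upperVelocity, if_neg (not_le.2 h0), if_neg (not_le.2 h1')] at hc
    set e := (p.2 - 1) / 2 with he
    have he0 : 0 < e := by linarith
    -- For `y > 1 + e` and `n ≥ N` the restoring term exceeds `2 (|H p| + 1) > 2 |H q|`, so the sum
    -- lies below `-|H q|` and is clipped to it.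
    obtain ⟨N, hN⟩ := exists_nat_ge (2 * (|H p| + 1) / e)
    rw [div_le_iff₀ he0] at hN
    have hn : ∀ᶠ x : ℕ × (ℝ × ℝ) in atTop ×ˢ 𝓝 p, N ≤ x.1 :=
      tendsto_fst.eventually (eventually_ge_atTop N)
    filter_upwards [hn, hq.eventually ((hH.abs.neg.tendsto p).eventually_lt_const hc),
      hq.eventually ((hH.abs.tendsto p).eventually_lt_const (lt_add_one |H p|)),
      hq.eventually ((continuous_snd.tendsto p).eventually_const_lt
        (show 1 + e < p.2 by linarith))] with x hxn hx hx1 hx2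
    refine lt_of_le_of_lt ((min_le_right _ _).trans (max_le le_rfl ?_)) hx
    rw [max_eq_right (a := -x.2.2) (by linarith), max_eq_left (a := x.2.2 - 1) (by linarith)]
    have hxn' : (N : ℝ) ≤ x.1 := by exact_mod_cast hxn
    have : (N : ℝ) * e ≤ x.1 * (x.2.2 - 1) :=
      mul_le_mul hxn' (by linarith) he0.le (Nat.cast_nonneg _)
    linarith [le_abs_self (H x.2)]

theorem snd_regularizedField_eq_neg (G H : ℝ × ℝ → ℝ) (n : ℕ) (q : ℝ × ℝ) :
    (regularizedField G H n q).2 =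
      -(regularizedField G (fun q => -H (q.1, 1 - q.2)) n (q.1, 1 - q.2)).2 := by
  simp only [regularizedField, sub_sub_cancel, abs_neg, Prod.mk.eta]
  have hA := abs_nonneg (H q)
  have hB : -H q + (n * max (-(1 - q.2)) 0 + (-n) * max (1 - q.2 - 1) 0) =
      -(H q + (n * max (-q.2) 0 + (-n) * max (q.2 - 1) 0)) := by
    rw [neg_sub, sub_sub_cancel_left]
    ring
  rw [hB]
  generalize |H q| = A at hA
  generalize H q + (n * max (-q.2) 0 + (-n) * max (q.2 - 1) 0) = B
  rw [← max_neg_neg, ← min_neg_neg, neg_neg, neg_neg, max_min_distrib_left, max_comm (-A) A,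
    max_eq_left (by linarith : -A ≤ A)]

theorem eventually_lt_snd_regularizedField {G H : ℝ × ℝ → ℝ} (hH : Continuous H) (p : ℝ × ℝ)
    {c : ℝ} (hc : c < lowerVelocity H p) :
    ∀ᶠ x : ℕ × (ℝ × ℝ) in atTop ×ˢ 𝓝 p, c < (regularizedField G H x.1 x.2).2 := by
  rw [lowerVelocity_eq_neg] at hc
  have hH' : Continuous fun q : ℝ × ℝ => -H (q.1, 1 - q.2) := by fun_prop
  have h := eventually_snd_regularizedField_lt (G := G) hH' (p.1, 1 - p.2) (c := -c) (by linarith)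
  have hφ : Continuous fun q : ℝ × ℝ => (q.1, 1 - q.2) := by fun_prop
  filter_upwards [(tendsto_id.prodMap (hφ.tendsto p)).eventually h] with x hx
  rw [snd_regularizedField_eq_neg]
  have : (regularizedField G (fun q => -H (q.1, 1 - q.2)) x.1 (x.2.1, 1 - x.2.2)).2 < -c := hx
  linarith

/-! ### Local existence by passing to the limit -/

/-- The Picard fixed point is sought among curves confined to the ball; keeping this information
yields bounds uniform in `n` later. -/
theorem IsPicardLindelof.exists_mem_closedBall_hasDerivWithinAt {E : Type*} [NormedAddCommGroup E]
    [NormedSpace ℝ E] [CompleteSpace E] {f : ℝ → E → E} {tmin tmax : ℝ} {t₀ : Icc tmin tmax}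
    {x₀ : E} {a L K : NNReal} (hf : IsPicardLindelof f t₀ x₀ a 0 L K) :
    ∃ α : ℝ → E, α t₀ = x₀ ∧ (∀ t, α t ∈ Metric.closedBall x₀ a) ∧
      ∀ t ∈ Icc tmin tmax, HasDerivWithinAt α (f t (α t)) (Icc tmin tmax) t := by
  have hx : x₀ ∈ Metric.closedBall x₀ ((0 : NNReal) : ℝ) := by simp
  obtain ⟨α, hα⟩ := ODE.FunSpace.exists_isFixedPt_next hf hx
  refine ⟨α.compProj, by rw [ODE.FunSpace.compProj_val, ← hα, ODE.FunSpace.next_apply₀],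
    fun t => α.compProj_mem_closedBall hf.mul_max_le, fun t ht => ?_⟩
  apply ODE.hasDerivWithinAt_picard_Icc t₀.2 hf.continuousOn_uncurry
    α.continuous_compProj.continuousOn (fun _ _ => α.compProj_mem_closedBall hf.mul_max_le) x₀ ht
    |>.congr_of_mem _ ht
  intro t' ht'
  nth_rw 1 [← hα]
  rw [ODE.FunSpace.compProj_of_mem ht', ODE.FunSpace.next_apply]

/-- If a sequence of functions converges pointwise along a filter and their derivatives near `t` are
eventually at most `c`, then any derivative of the limit at `t` is at most `c`. -/
theorem HasDerivAt.le_of_tendsto_of_deriv_le {ι : Type*} {F : Filter ι} [F.NeBot] {u : ι → ℝ → ℝ}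
    {g : ι → ℝ → ℝ} {v : ℝ → ℝ} {t δ d c : ℝ} (hδ : 0 < δ)
    (hv : ∀ s ∈ Ico t (t + δ), Tendsto (fun i => u i s) F (𝓝 (v s))) (hd : HasDerivAt v d t)
    (hu : ∀ᶠ i in F, ∀ s ∈ Ico t (t + δ), HasDerivWithinAt (u i) (g i s) (Ici s) s ∧ g i s ≤ c)
    (huc : ∀ i, ContinuousOn (u i) (Ico t (t + δ))) : d ≤ c := by
  have hs : ∀ s ∈ Ioo t (t + δ), slope v t s ≤ c := by
    intro s hs
    have hsub : Icc t s ⊆ Ico t (t + δ) := fun r hr => ⟨hr.1, hr.2.trans_lt hs.2⟩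
    have : v s ≤ v t + c * (s - t) := by
      refine le_of_tendsto_of_tendsto (hv s ⟨hs.1.le, hs.2⟩)
        ((hv t ⟨le_rfl, by linarith⟩).add_const (c * (s - t))) ?_
      filter_upwards [hu] with i hi
      refine image_le_of_deriv_right_le_deriv_boundary (f := u i) (f' := g i) (a := t) (b := s)
        (B := fun r => u i t + c * (r - t)) (B' := fun _ => c) ((huc i).mono hsub)
        (fun r hr => (hi r (hsub (Ico_subset_Icc_self hr))).1) (by simp) (by fun_prop)
        (fun r hr => ?_) (fun r hr => (hi r (hsub (Ico_subset_Icc_self hr))).2)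
        (right_mem_Icc.2 hs.1.le)
      have := (((hasDerivAt_id r).sub_const t).const_mul c).const_add (u i t)
      simpa using this.hasDerivWithinAt
    rw [slope_def_field, div_le_iff₀ (by linarith [hs.1])]
    linarith
  have h1 := (hasDerivAt_iff_tendsto_slope.1 hd).mono_left
    (nhdsWithin_mono t (show Ioi t ⊆ {t}ᶜ from fun s hs => ne_of_gt hs))
  refine le_of_tendsto h1 ?_
  filter_upwards [Ioo_mem_nhdsGT (show t < t + δ by linarith)] with s h using hs s h

theorem exists_lipschitzOnWith_and_mem_filippovSet {G H : ℝ × ℝ → ℝ} (hG : ContDiff ℝ 1 G)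
    (hH : ContDiff ℝ 1 H) (b : ℝ) (p : ℝ × ℝ) :
    ∃ ε > 0, ∃ (M : NNReal) (z : ℝ → ℝ × ℝ), z b = p ∧ LipschitzOnWith M z (Icc b (b + ε)) ∧
      ∀ t ∈ Ioo b (b + ε), ∀ v, HasDerivAt z v t → v ∈ filippovSet (stripField G H) (z t) := by
  have hball := isCompact_closedBall p 1
  obtain ⟨M₁, hM₁⟩ := hball.exists_bound_of_continuousOn hG.continuous.continuousOn
  obtain ⟨M₂, hM₂⟩ := hball.exists_bound_of_continuousOn hH.continuous.continuousOn
  set M : NNReal := max M₁.toNNReal M₂.toNNReal with hM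
  have hbound : ∀ n, ∀ q ∈ Metric.closedBall p ((1 : NNReal) : ℝ),
      ‖regularizedField G H n q‖ ≤ M := by
    intro n q hq
    rw [NNReal.coe_one] at hq
    refine max_le ?_ ?_
    · exact (hM₁ q hq).trans ((Real.le_coe_toNNReal _).trans
        (NNReal.coe_le_coe.2 (le_max_left _ _)))
    · exact (abs_snd_regularizedField_le G H n q).trans ((hM₂ q hq).trans
        ((Real.le_coe_toNNReal _).trans (NNReal.coe_le_coe.2 (le_max_right _ _))))
  -- At speed at most `M`, a solution stays in the unit ball for time `1 / (M + 1)`, whatever `n`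
  -- is.
  set ε : ℝ := 1 / (M + 1) with hε
  have hM0 : (0 : ℝ) ≤ M := M.2
  have hε0 : 0 < ε := by positivity
  have hMε : M * ε ≤ 1 := by
    rw [hε, mul_one_div, div_le_one (by positivity)]
    linarith
  have hsol : ∀ n, ∃ u : ℝ → ℝ × ℝ, u b = p ∧
      (∀ t, u t ∈ Metric.closedBall p ((1 : NNReal) : ℝ)) ∧ ∀ t ∈ Icc b (b + ε),
        HasDerivWithinAt u (regularizedField G H n (u t)) (Icc b (b + ε)) t := by
    intro n
    obtain ⟨K, hK⟩ := (locallyLipschitz_regularizedField hG hH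
      n).locallyLipschitzOn.exists_lipschitzOnWith_of_compact
        (isCompact_closedBall p ((1 : NNReal) : ℝ))
    have hpl : IsPicardLindelof (fun _ => regularizedField G H n)
        (⟨b, left_mem_Icc.2 (by linarith)⟩ : Icc b (b + ε)) p 1 0 M K :=
      IsPicardLindelof.of_time_independent (hbound n) hK (by
        simpa [max_eq_left hε0.le] using hMε)
    exact hpl.exists_mem_closedBall_hasDerivWithinAt
  choose u hub hmem hder using hsol
  have hlip : ∀ n, LipschitzOnWith M (u n) (Icc b (b + ε)) := fun n =>
    (convex_Icc b (b + ε)).lipschitzOnWith_of_nnnorm_hasDerivWithin_le (hder n)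
      fun t _ => hbound n _ (hmem n t)
  -- Along an ultrafilter, bounded sequences converge at every time simultaneously, which takes the
  -- place of an Arzelà–Ascoli subsequence.
  set F : Ultrafilter ℕ := hyperfilter ℕ with hF
  have hlim : ∀ t, ∃ q, Tendsto (fun n => u n t) F (𝓝 q) := fun t => by
    obtain ⟨q, -, hq⟩ := (isCompact_closedBall p ((1 : NNReal) : ℝ)).ultrafilter_le_nhds
      (F.map fun n => u n t) (by
        rw [le_principal_iff]
        exact (Eventually.of_forall fun n => hmem n t :
          ∀ᶠ n in (F : Filter ℕ), u n t ∈ Metric.closedBall p ((1 : NNReal) : ℝ)))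
    exact ⟨q, hq⟩
  choose z hz using hlim
  have hzlip : LipschitzOnWith M z (Icc b (b + ε)) :=
    LipschitzOnWith.of_dist_le_mul fun s hs t ht =>
      le_of_tendsto ((hz s).dist (hz t))
        (Eventually.of_forall fun n => (hlip n).dist_le_mul s hs t ht)
  refine ⟨ε, hε0, M, z, tendsto_nhds_unique (hz b) (by simp [hub]), hzlip, fun t ht v hv => ?_⟩
  -- A half-plane containing the approximating velocities for large `n` near `z t` contains `v` in
  -- its closure. As the Filippov set is a box, the functionals `±fst` and `±snd` suffice.
  have key : ∀ (ℓ : ℝ × ℝ →L[ℝ] ℝ) (c : ℝ), (∀ᶠ x : ℕ × (ℝ × ℝ) in atTop ×ˢ 𝓝 (z t),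
      ℓ (regularizedField G H x.1 x.2) < c) → ℓ v ≤ c := by
    intro ℓ c hc
    obtain ⟨P, hP, Q, hQ, hPQ⟩ := eventually_prod_iff.1 hc
    obtain ⟨η, hη, hηQ⟩ := Metric.eventually_nhds_iff_ball.1 hQ
    -- Half of `η` absorbs the distance from `u n t` to `z t`, the other half the motion of `u n`
    -- during time `δ`.
    set δ := min (b + ε - t) (η / (2 * (M + 1))) with hδ
    have hδ0 : 0 < δ := lt_min (by linarith [ht.2]) (by positivity)
    have hδη : M * δ ≤ η / 2 := by
      have h1 : M * δ ≤ (M + 1) * (η / (2 * (M + 1))) :=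
        mul_le_mul (by linarith) (min_le_right _ _) hδ0.le (by positivity)
      have h2 : ((M : ℝ) + 1) * (η / (2 * (M + 1))) = η / 2 := by field_simp
      linarith
    have hsub : ∀ s ∈ Ico t (t + δ), s ∈ Ico b (b + ε) := fun s hs =>
      ⟨ht.1.le.trans hs.1, by linarith [hs.2, min_le_left (b + ε - t) (η / (2 * (M + 1)))]⟩
    have hFat : (F : Filter ℕ) ≤ atTop := Nat.hyperfilter_le_atTop
    refine HasDerivAt.le_of_tendsto_of_deriv_le (F := (F : Filter ℕ)) (u := fun n s => ℓ (u n s))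
      (g := fun n s => ℓ (regularizedField G H n (u n s))) (v := fun s => ℓ (z s)) hδ0
      (fun s _ => (ℓ.continuous.tendsto _).comp (hz s)) (ℓ.hasFDerivAt.comp_hasDerivAt t hv) ?_ ?_
    · filter_upwards [hFat hP, (hz t).eventually (Metric.ball_mem_nhds (z t) (half_pos hη))]
        with n hn hnt s hs
      have hs' := hsub s hs
      refine ⟨ℓ.hasFDerivAt.comp_hasDerivWithinAt s ((hder n s
        (Ico_subset_Icc_self hs')).mono_of_mem_nhdsWithin (Icc_mem_nhdsGE_of_mem hs')),
        (hPQ hn (hηQ _ ?_)).le⟩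
      have h1 := (hlip n).dist_le_mul s (Ico_subset_Icc_self hs') t (Ioo_subset_Icc_self ht)
      rw [Real.dist_eq, abs_of_nonneg (by linarith [hs.1])] at h1
      have h2 : (M : ℝ) * (s - t) ≤ M * δ := mul_le_mul_of_nonneg_left (by linarith [hs.2]) hM0
      have h3 := dist_triangle (u n s) (u n t) (z t)
      exact Metric.mem_ball.2 (by linarith [Metric.mem_ball.1 hnt])
    · exact fun n => ℓ.continuous.comp_continuousOn
        ((hlip n).continuousOn.mono fun s hs => Ico_subset_Icc_self (hsub s hs))
  rw [mem_filippovSet_stripField_iff hG.continuous hH.continuous]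
  have hGt : Tendsto (fun x : ℕ × (ℝ × ℝ) => G x.2) (atTop ×ˢ 𝓝 (z t)) (𝓝 (G (z t))) :=
    (hG.continuous.tendsto _).comp tendsto_snd
  refine ⟨le_antisymm ?_ ?_, ?_, ?_⟩
  · refine le_of_forall_gt_imp_ge_of_dense fun c hc => ?_
    exact key (ContinuousLinearMap.fst ℝ ℝ ℝ) c (hGt.eventually_lt_const hc)
  · refine neg_le_neg_iff.1 (le_of_forall_gt_imp_ge_of_dense fun c hc => ?_)
    exact key (-ContinuousLinearMap.fst ℝ ℝ ℝ) c (hGt.neg.eventually_lt_const hc)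
  · refine neg_le_neg_iff.1 (le_of_forall_gt_imp_ge_of_dense fun c hc => ?_)
    refine key (-ContinuousLinearMap.snd ℝ ℝ ℝ) c ?_
    filter_upwards [eventually_lt_snd_regularizedField (G := G) hH.continuous (z t) (c := -c)
      (by linarith)] with x hx using neg_lt.1 hx
  · refine le_of_forall_gt_imp_ge_of_dense fun c hc => ?_
    exact key (ContinuousLinearMap.snd ℝ ℝ ℝ) c
      (eventually_snd_regularizedField_lt (G := G) hH.continuous (z t) hc)

/-! ### Continuation and the maximal solution -/

namespace IsFilippovSolution

variable {G H : ℝ × ℝ → ℝ} {w : ℝ → ℝ × ℝ}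

/-- Every Filippov solution on a compact interval can be continued beyond its right end point. -/
theorem exists_extension (hG : ContDiff ℝ 1 G) (hH : ContDiff ℝ 1 H) {a b : ℝ} (hab : a ≤ b)
    (hw : IsFilippovSolution (stripField G H) (Icc a b) w) :
    ∃ ε > 0, ∃ z : ℝ → ℝ × ℝ, z a = w a ∧
      IsFilippovSolution (stripField G H) (Icc a (b + ε)) z := by
  obtain ⟨M, hM⟩ := hw.exists_lipschitzOnWith_Icc hG.continuous hH.continuous hab
  obtain ⟨ε, hε, K, u, hub, hu, hud⟩ := exists_lipschitzOnWith_and_mem_filippovSet hG hH b (w b)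
  -- Gluing by freezing `w` after `b` and `u` before `b`: a sum of Lipschitz maps, so `z` is
  -- Lipschitz without cases.
  set z : ℝ → ℝ × ℝ := fun t => w (min t b) + (u (max t b) - w b) with hz
  have hzw : ∀ t ≤ b, z t = w t := fun t ht => by simp [hz, ht, hub]
  have hzu : ∀ t ≥ b, z t = u t := fun t ht => by simp [hz, ge_iff_le.1 ht]
  have hab' : a ≤ b + ε := by linarith
  have hlip : LipschitzOnWith (M * 1 + (K * 1 + 0)) z (Icc a (b + ε)) := by
    have hmin : LipschitzWith 1 fun t : ℝ => min t b := LipschitzWith.id.min_const b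
    have hmax : LipschitzWith 1 fun t : ℝ => max t b := LipschitzWith.id.max_const b
    refine (hM.comp (hmin.lipschitzOnWith (s := Icc a (b + ε))) ?_).add
      ((hu.comp (hmax.lipschitzOnWith (s := Icc a (b + ε))) ?_).sub
        (LipschitzWith.const (w b)).lipschitzOnWith)
    · exact fun t ht => ⟨le_min ht.1 hab, min_le_right _ _⟩
    · exact fun t ht => ⟨le_max_right _ _, max_le ht.2 (by linarith)⟩
  refine ⟨ε, hε, z, hzw a hab, ordConnected_Icc, fun s hs t ht hst => ?_, ?_⟩
  · exact (hlip.mono (uIcc_subset_Icc hs ht)).absolutelyContinuousOnInterval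
  · filter_upwards [hw.ae_hasDerivAt, compl_mem_ae_iff.2 (measure_singleton b),
      hlip.ae_differentiableWithinAt_of_mem] with t htw htb htd hmem
    rw [interior_Icc] at hmem htw
    rcases lt_or_gt_of_ne (show t ≠ b from htb) with hlt | hgt
    · obtain ⟨v, hv, hd⟩ := htw ⟨hmem.1, hlt⟩
      refine ⟨v, by rwa [hzw t hlt.le], hd.congr_of_eventuallyEq ?_⟩
      filter_upwards [Iio_mem_nhds hlt] with r hr using hzw r (le_of_lt hr)
    · have hdz := ((htd (Ioo_subset_Icc_self hmem)).differentiableAt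
        (Icc_mem_nhds hmem.1 hmem.2)).hasDerivAt
      refine ⟨_, ?_, hdz⟩
      rw [hzu t hgt.le]
      refine hud t ⟨hgt, hmem.2⟩ _ (hdz.congr_of_eventuallyEq ?_)
      filter_upwards [Ioi_mem_nhds hgt] with r hr using (hzu r (le_of_lt hr)).symm

theorem const_singleton (f : ℝ × ℝ → ℝ × ℝ) (a : ℝ) (p : ℝ × ℝ) :
    IsFilippovSolution f (Icc a a) fun _ => p where
  ordConnected := ordConnected_Icc
  absolutelyContinuous _ _ _ _ _ :=
    (LipschitzWith.const p).lipschitzOnWith.absolutelyContinuousOnInterval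
  ae_hasDerivAt := by simp

/-- The unique maximal forward solution of an initial value problem. -/
theorem exists_maximal (hG : ContDiff ℝ 1 G) (hH : ContDiff ℝ 1 H) (z₀ : ℝ × ℝ) :
    ∃ T : EReal, 0 < T ∧ ∃ z : ℝ → ℝ × ℝ,
      z 0 = z₀ ∧ IsFilippovSolution (stripField G H) (forwardInterval T) z ∧
      ∀ (J : Set ℝ) (w : ℝ → ℝ × ℝ), J ⊆ Ici 0 → (0 : ℝ) ∈ J → w 0 = z₀ →
        IsFilippovSolution (stripField G H) J w → J ⊆ forwardInterval T ∧ EqOn w z J := by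
  set S : Set ℝ := {τ | 0 ≤ τ ∧ ∃ u : ℝ → ℝ × ℝ, u 0 = z₀ ∧
    IsFilippovSolution (stripField G H) (Icc 0 τ) u} with hS
  have hS0 : (0 : ℝ) ∈ S := ⟨le_rfl, fun _ => z₀, rfl, const_singleton _ _ _⟩
  have hext : ∀ τ ∈ S, ∃ σ ∈ S, τ < σ := by
    rintro τ ⟨h0, u, hu0, hu⟩
    obtain ⟨ε, hε, u', hu', hsol⟩ := hu.exists_extension hG hH h0
    exact ⟨τ + ε, ⟨by linarith, u', hu'.trans hu0, hsol⟩, by linarith⟩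
  have hdown : ∀ τ ∈ S, ∀ σ, 0 ≤ σ → σ ≤ τ → σ ∈ S := by
    rintro τ ⟨h0, u, hu0, hu⟩ σ hσ hστ
    exact ⟨hσ, u, hu0, hu.mono ordConnected_Icc (Icc_subset_Icc_right hστ)⟩
  set T : EReal := sSup ((fun t : ℝ => (t : EReal)) '' S) with hT
  -- No time in `S` is its largest, by continuation, so `S` is half-open.
  have hST : forwardInterval T = S := by
    ext t
    constructor
    · rintro ⟨h0, ht⟩
      obtain ⟨_, ⟨τ, hτ, rfl⟩, hlt⟩ := lt_sSup_iff.1 ht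
      exact hdown τ hτ t h0 (EReal.coe_lt_coe_iff.1 hlt).le
    · intro ht
      obtain ⟨σ, hσ, hlt⟩ := hext t ht
      exact ⟨ht.1, (EReal.coe_lt_coe_iff.2 hlt).trans_le (le_sSup ⟨σ, hσ, rfl⟩)⟩
  have hex : ∀ τ, ∃ u : ℝ → ℝ × ℝ, τ ∈ S → u 0 = z₀ ∧
      IsFilippovSolution (stripField G H) (Icc 0 τ) u := fun τ => by
    by_cases h : τ ∈ S
    · obtain ⟨-, u, hu⟩ := h
      exact ⟨u, fun _ => hu⟩
    · exact ⟨fun _ => z₀, fun h' => absurd h' h⟩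
  choose u hu using hex
  have heq : ∀ (J : Set ℝ) (w : ℝ → ℝ × ℝ), 0 ∈ J → w 0 = z₀ →
      IsFilippovSolution (stripField G H) J w → ∀ t ∈ J, t ∈ S → w t = u t t := by
    intro J w h0 hw0 hw t ht htS
    obtain ⟨hu0, husol⟩ := hu t htS
    exact eq_of_eq_left hG hH hw husol h0 ht (left_mem_Icc.2 htS.1) (right_mem_Icc.2 htS.1) htS.1
      (hw0.trans hu0.symm)
  -- The diagonal `u t t` agrees with every solution through `z₀`, by uniqueness.
  refine ⟨T, ?_, fun t => u t t, (hu 0 hS0).1, ?_, ?_⟩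
  · have : (0 : ℝ) ∈ forwardInterval T := hST ▸ hS0
    exact_mod_cast this.2
  · rw [hST]
    have hloc : ∀ τ ∈ S, IsFilippovSolution (stripField G H) (Icc 0 τ) fun t => u t t :=
      fun τ hτ => (hu τ hτ).2.congr fun t ht => heq _ _ (left_mem_Icc.2 hτ.1) (hu τ hτ).1
        (hu τ hτ).2 t ht (hdown τ hτ t ht.1 ht.2)
    refine ⟨⟨fun a ha b hb t ht => hdown b hb t (ha.1.trans ht.1) ht.2⟩,
      fun a ha b hb hab => (hloc b hb).absolutelyContinuous a ⟨ha.1, hab⟩ b ⟨hb.1, le_rfl⟩ hab, ?_⟩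
    -- The exceptional null set depends on the compact interval; rational end points leave only
    -- countably many to unite.
    have hrat : ∀ᵐ t : ℝ, ∀ q : ℚ, (q : ℝ) ∈ S → t ∈ interior (Icc (0 : ℝ) q) →
        ∃ v ∈ filippovSet (stripField G H) (u t t), HasDerivAt (fun t => u t t) v t := by
      rw [ae_all_iff]
      intro q
      by_cases hq : (q : ℝ) ∈ S
      · filter_upwards [(hloc q hq).ae_hasDerivAt] with t ht _ using ht
      · exact Eventually.of_forall fun t h => absurd h hq
    filter_upwards [hrat, compl_mem_ae_iff.2 (measure_singleton 0)] with t ht ht0 hmem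
    have htS := interior_subset hmem
    obtain ⟨σ, hσ, hlt⟩ := hext t htS
    obtain ⟨q, hq1, hq2⟩ := exists_rat_btwn hlt
    refine ht q (hdown σ hσ q (htS.1.trans hq1.le) hq2.le) ?_
    rw [interior_Icc]
    exact ⟨lt_of_le_of_ne htS.1 (Ne.symm ht0), hq1⟩
  · intro J w hJ h0 hw0 hw
    have hJS : J ⊆ S := fun t ht => ⟨hJ ht, w, hw0, hw.restrict_Icc h0 ht⟩
    exact ⟨hST ▸ hJS, fun t ht => heq J w h0 hw0 hw t ht (hJS ht)⟩

end IsFilippovSolution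

theorem theorem1 (G H : ℝ × ℝ → ℝ) (hG : ContDiff ℝ 1 G) (hH : ContDiff ℝ 1 H) :
    -- unique maximal forward-time solution of every initial value problem
    (∀ z₀ : ℝ × ℝ, ∃ T : EReal, 0 < T ∧ ∃ z : ℝ → ℝ × ℝ,
      z 0 = z₀ ∧ IsFilippovSolution (stripField G H) (forwardInterval T) z ∧
      ∀ (J : Set ℝ) (w : ℝ → ℝ × ℝ), J ⊆ Ici 0 → (0 : ℝ) ∈ J → w 0 = z₀ →
        IsFilippovSolution (stripField G H) J w →
        J ⊆ forwardInterval T ∧ EqOn w z J) ∧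
    (∀ (J : Set ℝ) (w : ℝ → ℝ × ℝ), IsFilippovSolution (stripField G H) J w →
      -- forward invariance of the strip
      (∀ s ∈ J, ∀ t ∈ J, s ≤ t → w s ∈ closedStrip → w t ∈ closedStrip) ∧
      -- the velocity on the boundary lines
      (∀ᵐ t : ℝ, t ∈ interior J → ((w t).2 = 0 ∨ (w t).2 = 1) →
        HasDerivAt w (G (w t), 0) t) ∧
      -- sliding along the upper line, as long as `H` does not point back into the strip
      (∀ s ∈ J, ∀ t ∈ J, s ≤ t → (w s).2 = 1 →
        (∀ r ∈ Icc s t, 0 ≤ H ((w r).1, 1)) →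
        ∀ r ∈ Icc s t, (w r).2 = 1 ∧ HasDerivWithinAt w (G (w r), 0) (Icc s t) r) ∧
      -- sliding along the lower line, as long as `H` does not point back into the strip
      (∀ s ∈ J, ∀ t ∈ J, s ≤ t → (w s).2 = 0 →
        (∀ r ∈ Icc s t, H ((w r).1, 0) ≤ 0) →
        ∀ r ∈ Icc s t, (w r).2 = 0 ∧ HasDerivWithinAt w (G (w r), 0) (Icc s t) r)) := by
  refine ⟨IsFilippovSolution.exists_maximal hG hH, fun J w hw => ⟨?_, ?_, ?_, ?_⟩⟩
  · exact fun s hs t ht hst h =>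
      ⟨hw.snd_nonneg hG.continuous hH.continuous hs ht hst h.1,
        hw.snd_le_one hG.continuous hH.continuous hs ht hst h.2⟩
  · exact hw.ae_hasDerivAt_of_mem_lines hG.continuous hH.continuous
  · intro s hs t ht hst h hpos r hr
    have key : ∀ q ∈ Icc s t, (w q).2 = 1 := fun q hq =>
      hw.snd_eq_one_of_nonneg hG.continuous hH hs (hw.ordConnected.out hs ht hq) hq.1 h
        fun r hr => hpos r ⟨hr.1, hr.2.trans hq.2⟩
    exact ⟨key r hr, hw.hasDerivWithinAt_of_snd_eq_const hG.continuous hH.continuous hs ht hst key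
      hr⟩
  · intro s hs t ht hst h hneg r hr
    have key : ∀ q ∈ Icc s t, (w q).2 = 0 := fun q hq =>
      hw.snd_eq_zero_of_nonpos hG.continuous hH hs (hw.ordConnected.out hs ht hq) hq.1 h
        fun r hr => hneg r ⟨hr.1, hr.2.trans hq.2⟩
    exact ⟨key r hr, hw.hasDerivWithinAt_of_snd_eq_const hG.continuous hH.continuous hs ht hst key
      hr⟩
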